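/- Let $p$ be a prime and let $F$ be a field that contains a primitive $p$-th root of unity if $p$ is odd, and a primitive fourth root of unity if $p=2$. Let $G_F=\mathrm{Gal}(F_{sep}/F)$ be the absolute Galois group of $F$ and let $G_F(p)$ be its maximal pro-$p$ quotient. Write $[g,h]=ghg^{-1}h^{-1}$. (a) Let $S$ be a free pro-$p$ group on a set of free generators $X=\{x\}\sqcup\{y_i\mid i\in I\}$ ($I$ arbitrary, possibly empty or infinite; in the infinite case $X$ converges to $1$), and let $$1\longrightarrow R\longrightarrow S\stackrel{\pi}{\longrightarrow} G_F(p)\longrightarrow 1$$ be a minimal presentation, i.e. $\pi$ is a continuous surjective homomorphism whose kernel $R$ is contained in the Frattini subgroup $\overline{S^p[S,S]}$ of $S$. A *hyper-commutator* is an iterated commutator $[u_1,\dots,u_k]$, $k\ge 2$, with arbitrary bracketing, of letters $u_j$ of the formal alphabet $X\sqcup X^{-1}$. A *commutator expression* for $s\in S$ is an expression $s=c_1\cdots c_t$ ($t\ge 0$) in which every $c_j$ is a hyper-commutator. A commutator $[a,b]$ of two letters $a,b\in X\sqcup X^{-1}$ *appears* in the expression if it is a sub-commutator of some $c_j$ (for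 example, $[u_1,u_2]$ appears in $[[u_1,u_2],u_3]$ and $[u_2,u_3]$ does not). Then $R$ contains no element of the form $r=x^{p^l n}s$, where $l\ge 1$ and $n$ are integers with $\gcd(p,n)=1$ and $s$ is an element of the closed commutator subgroup $[S,S]$ that has a commutator expression in which every appearing commutator $[a,b]$ of letters satisfies $a\ne x^{\pm1}$ and $b\neq x^{\pm 1}$. (b) In particular, let $n\ge 1$ be an odd integer, let $k\ge 1$ be an integer, let $S$ be a free pro-$p$ group on $x_1,\dots,x_n$, and let $\langle r\rangle$ be the closed normal subgroup of $S$ generated by $$r=x_1^{p^k}[x_2,x_3][x_4,x_5]\cdots[x_{n-1},x_n].$$ Then $S/\langle r\rangle$ is not isomorphic, as a topological group, to $G_F(p)$. -/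

import Mathlib

open Filter Topology
open scoped commutatorElement

universe u v w

namespace ProP

section Groups

variable (p : ℕ)

/-- A pro-`p` group: a compact totally disconnected topological group all of whose quotients by
open normal subgroups are (finite) `p`-groups. -/
structure IsProPGroup (G : Type u) [Group G] [TopologicalSpace G] [IsTopologicalGroup G] :
    Prop where
  compactSpace : CompactSpace G
  totallyDisconnectedSpace : TotallyDisconnectedSpace G
  isPGroup_quotient : ∀ (N : Subgroup G) [N.Normal], IsOpen (N : Set G) → IsPGroup p (G ⧸ N)

/-- `S` is the free pro-`p` group on the family of generators `ι : X → S`: the family converges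
to `1` (every neighbourhood of `1` contains all but finitely many generators), and every family
`f : X → P` in a pro-`p` group that converges to `1` extends uniquely to a continuous
homomorphism `S → P`. -/
structure IsFreeProPGroup {X : Type w} {S : Type v} [Group S] [TopologicalSpace S]
    [IsTopologicalGroup S] (ι : X → S) : Prop where
  isProPGroup : IsProPGroup p S
  tendsto_one : Tendsto ι cofinite (𝓝 1)
  existsUnique_extension : ∀ (P : Type v) [Group P] [TopologicalSpace P] [IsTopologicalGroup P],
    IsProPGroup p P → ∀ f : X → P, Tendsto f cofinite (𝓝 1) →
      ∃! φ : S →ₜ* P, ∀ a, φ (ι a) = f a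

/-- The Frattini subgroup of a pro-`p` group `S`: the closed subgroup generated by all `p`-th
powers and all commutators. -/
def frattiniSubgroup (S : Type v) [Group S] [TopologicalSpace S] [IsTopologicalGroup S] :
    Subgroup S :=
  (Subgroup.closure ({g | ∃ a : S, g = a ^ p} ∪ {g | ∃ a b : S, g = ⁅a, b⁆})).topologicalClosure

/-- `1 → ker π → S → G → 1` is a minimal presentation: `π` is onto and its kernel is contained in
the Frattini subgroup of `S`. -/
structure IsMinimalPresentation {S : Type v} [Group S] [TopologicalSpace S]
    [IsTopologicalGroup S] {G : Type u} [Group G] [TopologicalSpace G] (π : S →ₜ* G) : Prop where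
  surjective : Function.Surjective π
  ker_le_frattini : (π : S →* G).ker ≤ frattiniSubgroup p S

/-- The intersection of all open normal subgroups of `G` with quotient a `p`-group. -/
def proPKernel (G : Type u) [Group G] [TopologicalSpace G] : Subgroup G :=
  sInf {N : Subgroup G | ∃ _ : N.Normal, IsOpen (N : Set G) ∧ IsPGroup p (G ⧸ N)}

instance proPKernel_normal (G : Type u) [Group G] [TopologicalSpace G] :
    (proPKernel p G).Normal := by
  refine ⟨fun n hn g => ?_⟩
  rw [proPKernel, Subgroup.mem_sInf] at hn ⊢
  rintro N ⟨hN, h⟩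
  exact hN.conj_mem n (hn N ⟨hN, h⟩) g

/-- The maximal pro-`p` quotient of a profinite group, with the quotient topology. -/
abbrev MaxProPQuotient (G : Type u) [Group G] [TopologicalSpace G] : Type u :=
  G ⧸ proPKernel p G

/-- The absolute Galois group of `F`, with the Krull topology. -/
abbrev AbsGal (F : Type u) [Field F] : Type u := SeparableClosure F ≃ₐ[F] SeparableClosure F

/-- The maximal pro-`p` quotient of the absolute Galois group of `F`. -/
abbrev GalP (F : Type u) [Field F] : Type u := MaxProPQuotient p (AbsGal F)

/-- `F` contains a primitive `p`-th root of unity if `p` is odd, and a primitive fourth root of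
unity if `p = 2`. -/
def HasRootsOfUnity (F : Type u) [Field F] : Prop :=
  (p ≠ 2 → ∃ ζ : F, IsPrimitiveRoot ζ p) ∧ (p = 2 → ∃ ζ : F, IsPrimitiveRoot ζ 4)

end Groups

/-- The closed normal subgroup generated by `r`. -/
def closedNormalClosure {S : Type v} [Group S] [TopologicalSpace S] [IsTopologicalGroup S]
    (r : S) : Subgroup S :=
  (Subgroup.normalClosure {r}).topologicalClosure

instance closedNormalClosure_normal {S : Type v} [Group S] [TopologicalSpace S]
    [IsTopologicalGroup S] (r : S) : (closedNormalClosure r).Normal :=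
  Subgroup.is_normal_topologicalClosure _

/-- A letter of the formal alphabet `X ⊔ X⁻¹`. -/
inductive Letter (X : Type w) : Type w
  | pos (a : X) : Letter X
  | neg (a : X) : Letter X

/-- A formal iterated commutator, with arbitrary bracketing, of letters in `A`; a single letter
is allowed as the degenerate case of length one. -/
inductive BracketWord (A : Type w) : Type w
  | letter (a : A) : BracketWord A
  | bracket (b c : BracketWord A) : BracketWord A

/-- The letter `a` or `a⁻¹` as a group element. -/
def Letter.eval {X : Type w} {S : Type v} [Group S] (ι : X → S) : Letter X → S
  | .pos a => ι a
  | .neg a => (ι a)⁻¹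

namespace BracketWord

/-- The value of an iterated commutator, where `⁅g, h⁆ = g * h * g⁻¹ * h⁻¹`. -/
def eval {X : Type w} {S : Type v} [Group S] (ι : X → S) : BracketWord (Letter X) → S
  | letter a => a.eval ι
  | bracket b c => ⁅b.eval ι, c.eval ι⁆

/-- `c` is a hyper-commutator, that is, it has at least two letters. -/
def IsHyperCommutator {A : Type w} (c : BracketWord A) : Prop :=
  ∃ b b' : BracketWord A, c = bracket b b'

/-- The commutator `[a, b]` of two letters appears in the given word as a sub-commutator. -/
def Appears {A : Type w} (a b : A) : BracketWord A → Prop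
  | letter _ => False
  | bracket c d => (c = letter a ∧ d = letter b) ∨ Appears a b c ∨ Appears a b d

end BracketWord

/-- The list `cs = [c₁, …, cₖ]` of hyper-commutators in the letters `X ⊔ X⁻¹` is a commutator
expression `s = c₁ ⋯ cₖ`. -/
def IsCommutatorExpression {X : Type w} {S : Type v} [Group S] (ι : X → S)
    (cs : List (BracketWord (Letter X))) (s : S) : Prop :=
  (∀ c ∈ cs, c.IsHyperCommutator) ∧ s = (cs.map (BracketWord.eval ι)).prod

/-- The family of generators `{x} ∪ {y i | i ∈ I}`, where `none` indexes `x`. -/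
def generators {I : Type w} {S : Type v} (x : S) (y : I → S) : Option I → S
  | none => x
  | some i => y i

/-- The letter is neither `x` nor `x⁻¹`. -/
def Letter.AvoidsX {I : Type w} (a : Letter (Option I)) : Prop :=
  a ≠ .pos none ∧ a ≠ .neg none

/-- The word `x₁ ^ (p ^ k) [x₂, x₃] [x₄, x₅] ⋯ [x₂ₘ, x₂ₘ₊₁]` in `n = 2 m + 1` generators
(numbered from `0` in the code). -/
def oddRelation (p k m : ℕ) {S : Type v} [Group S] (x : Fin (2 * m + 1) → S) : S :=
  x 0 ^ p ^ k *
    (List.ofFn fun j : Fin m =>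
      ⁅x ⟨2 * j + 1, by omega⟩, x ⟨2 * j + 2, by omega⟩⁆).prod

end ProP

/-! Suppose the word `x ^ (p ^ l * n) * s` were a relation. Kummer theory yields a finite quotient
of the Galois group in which it survives. Let `ζ` be a primitive `p ^ (l + 1)`-th root of unity in
the separable closure. There is `α` with `α ^ p ^ (l + 1)` in `F` such that, on lifts of the
generators, `x` sends `α` to `ζ * α` and every `y i` fixes `α`
(`exists_kummer_element_of_minimalPresentation`). The existence of `α` is where absolute Galois
groups are special: by Hilbert 90, Kummer cocycles with values in roots of unity of order `p ^ m`
can be prescribed freely on the generators.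

Let the group act on the roots of `α ^ p ^ (l + 1)`; the image is a `p`-group, so the action factors
through `GalP p F`. Elements fixing `α` act only through the cyclotomic character, hence the `y i`
commute there and `s` dies (`BracketWord.map_eval_eq_one`). So `x ^ p ^ l` would fix `α`. But it
multiplies `α` by `ζ` to the power `1 + t + ⋯ + t ^ (p ^ l - 1)`, where `x` acts on `ζ` as the
`t`-th power. The roots of unity in `F` force `t ≡ 1` mod `p` (mod `4` if `p = 2`), so this sum is
`p ^ l` times a number prime to `p`, and `α` moves (`pow_apply_ne`). -/

namespace ProP

/-! ### Divisibility of geometric sums by `p` -/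

section GeometricSums

/-- `q ≡ 1` modulo `p`, and modulo `4` if `p = 2`. -/
def IsOneUnit (p q : ℕ) : Prop := q ≡ 1 [MOD p] ∧ (p = 2 → q ≡ 1 [MOD 4])

lemma IsOneUnit.pow {p q : ℕ} (h : IsOneUnit p q) (n : ℕ) : IsOneUnit p (q ^ n) :=
  ⟨by simpa using h.1.pow n, fun hp => by simpa using (h.2 hp).pow n⟩

lemma IsOneUnit.one_le {p q : ℕ} (hp : p.Prime) (h : IsOneUnit p q) : 1 ≤ q := by
  rcases Nat.eq_zero_or_pos q with rfl | hq
  · have := (Nat.modEq_zero_iff_dvd.1 h.1.symm)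
    exact absurd (Nat.dvd_one.1 this) hp.one_lt.ne'
  · exact hq

/-- The sum is `p` modulo `p ^ 2`. For `p = 2` it is `1 + q`, which is why `q ≡ 1` mod `4` is
needed. -/
lemma IsOneUnit.exists_geom_sum {p q : ℕ} (hp : p.Prime) (h : IsOneUnit p q) :
    ∃ k, ∑ i ∈ Finset.range p, q ^ i = p * (1 + p * k) := by
  rcases hp.eq_two_or_odd' with rfl | hodd
  · obtain ⟨b, hb⟩ := (Nat.modEq_iff_dvd' (h.one_le hp)).1 (h.2 rfl).symm
    have := h.one_le hp
    refine ⟨b, ?_⟩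
    simp only [Finset.sum_range_succ, Finset.sum_range_zero, pow_zero, pow_one]
    omega
  · obtain ⟨b, hb⟩ := (Nat.modEq_iff_dvd' (h.one_le hp)).1 h.1.symm
    have hq : (q : ℤ) = 1 + p * b := by
      have := h.one_le hp
      have h2 : q = 1 + p * b := by omega
      exact_mod_cast h2
    have h1 := odd_sq_dvd_geom_sum₂_sub (R := ℤ) (a := 1) (b := b) hodd
    simp only [one_pow, mul_one, ← hq] at h1
    have hle : p ≤ ∑ i ∈ Finset.range p, q ^ i := by
      calc p = ∑ i ∈ Finset.range p, 1 := by simp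
        _ ≤ _ := Finset.sum_le_sum fun i _ => Nat.one_le_pow _ _ (h.one_le hp)
    have h2 : p ^ 2 ∣ (∑ i ∈ Finset.range p, q ^ i) - p := by
      zify [hle]
      exact h1
    obtain ⟨k, hk⟩ := h2
    refine ⟨k, ?_⟩
    have : ∑ i ∈ Finset.range p, q ^ i = p ^ 2 * k + p := by omega
    rw [this]; ring

end GeometricSums

/-! ### Galois action on roots of unity and on radicals -/

section Kummer

variable {F : Type u} {K : Type v} [Field F] [Field K] [Algebra F K]

lemma isOpen_fixingSubgroup_of_finite [Algebra.IsAlgebraic F K] {T : Set K} (hT : T.Finite) :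
    IsOpen (fixingSubgroup (K ≃ₐ[F] K) T : Set (K ≃ₐ[F] K)) := by
  have := hT.to_subtype
  have : FiniteDimensional F (IntermediateField.adjoin F T) :=
    IntermediateField.finiteDimensional_adjoin
      fun x _ => (Algebra.IsAlgebraic.isAlgebraic x).isIntegral
  refine Subgroup.isOpen_mono ?_ (IntermediateField.adjoin F T).fixingSubgroup_isOpen
  intro σ hσ
  rw [mem_fixingSubgroup_iff]
  intro y hy
  exact (IntermediateField.mem_fixingSubgroup_iff _ _).1 hσ y (IntermediateField.subset_adjoin F T hy)

/-- The automorphisms that fix all `n`-th roots of `α ^ n`. -/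
def rootsFixer (F : Type u) {K : Type v} [Field F] [Field K] [Algebra F K] (n : ℕ) (α : K) :
    Subgroup (K ≃ₐ[F] K) :=
  fixingSubgroup (K ≃ₐ[F] K) {β : K | β ^ n = α ^ n}

lemma mem_rootsFixer {n : ℕ} {α : K} {σ : K ≃ₐ[F] K} :
    σ ∈ rootsFixer F n α ↔ ∀ β, β ^ n = α ^ n → σ β = β := by
  simp [rootsFixer, mem_fixingSubgroup_iff]

lemma isOpen_rootsFixer [Algebra.IsAlgebraic F K] {n : ℕ} (hn : 0 < n) (α : K) :
    IsOpen (rootsFixer F n α : Set (K ≃ₐ[F] K)) := by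
  classical
  refine isOpen_fixingSubgroup_of_finite (Set.Finite.subset
    (Polynomial.nthRoots n (α ^ n)).toFinset.finite_toSet ?_)
  intro β hβ
  simpa [Polynomial.mem_nthRoots hn] using hβ

lemma apply_pow_eq {n : ℕ} {α : K} (hα : α ^ n ∈ Set.range (algebraMap F K)) (σ : K ≃ₐ[F] K) :
    (σ α) ^ n = α ^ n := by
  obtain ⟨c, hc⟩ := hα
  rw [← map_pow, ← hc, σ.commutes]

lemma rootsFixer_normal {n : ℕ} {α : K} (hα : α ^ n ∈ Set.range (algebraMap F K)) :
    (rootsFixer F n α).Normal := by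
  refine ⟨fun σ hσ τ => ?_⟩
  rw [mem_rootsFixer] at hσ ⊢
  intro β hβ
  have h := hσ (τ⁻¹ β) ((apply_pow_eq (hβ ▸ hα) τ⁻¹).trans hβ)
  simp only [AlgEquiv.mul_apply, h]
  exact AlgEquiv.apply_symm_apply τ β

/-- A root of unity whose order divides that of a primitive root in `F` lies in `F`. -/
lemma mem_range_algebraMap_of_pow_eq_one {d : ℕ} [NeZero d] {η : F} (hη : IsPrimitiveRoot η d)
    {ω : K} (hω : ω ^ d = 1) : ∃ c : F, c ^ d = 1 ∧ algebraMap F K c = ω := by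
  obtain ⟨i, -, hi⟩ := (hη.map_of_injective (algebraMap F K).injective).eq_pow_of_pow_eq_one hω
  exact ⟨η ^ i, by rw [← pow_mul, mul_comm, pow_mul, hη.pow_eq_one, one_pow], by simpa using hi⟩

/-- By induction applied to `γ ^ p`, the power `τ = σ ^ p ^ m` fixes `γ ^ p`. Hence `τ` multiplies
`γ` by a `p`-th root of unity lying in `F`, which `τ` fixes, so `τ ^ p` fixes `γ`. -/
lemma pow_apply_eq_self {p : ℕ} [NeZero p] {η : F} (hη : IsPrimitiveRoot η p) (σ : K ≃ₐ[F] K)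
    (m : ℕ) (γ : K) (hγ : σ (γ ^ p ^ m) = γ ^ p ^ m) : (σ ^ p ^ m) γ = γ := by
  induction m generalizing γ with
  | zero => simpa using hγ
  | succ m ih =>
    rcases eq_or_ne γ 0 with rfl | h0
    · simp
    have h1 : (σ ^ p ^ m) (γ ^ p) = γ ^ p := ih (γ ^ p) (by rw [← pow_mul, ← pow_succ']; exact hγ)
    rw [pow_succ, pow_mul]
    set τ := σ ^ p ^ m
    obtain ⟨c, hc, hcω⟩ := mem_range_algebraMap_of_pow_eq_one (K := K) hη (ω := τ γ / γ)
      (by rw [div_pow, ← map_pow, h1, div_self (pow_ne_zero _ h0)])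
    have h2 : τ γ = algebraMap F K c * γ := by rw [hcω, div_mul_cancel₀ _ h0]
    have h3 : ∀ j : ℕ, (τ ^ j) γ = algebraMap F K (c ^ j) * γ := by
      intro j
      induction j with
      | zero => simp
      | succ j ihj =>
        rw [pow_succ', AlgEquiv.mul_apply, ihj, map_mul, τ.commutes, h2, pow_succ, map_mul,
          mul_assoc]
    rw [h3, hc]; simp

lemma pow_mem_rootsFixer {p : ℕ} [NeZero p] {η : F} (hη : IsPrimitiveRoot η p) {m : ℕ} {α : K}
    (hα : α ^ p ^ m ∈ Set.range (algebraMap F K)) (σ : K ≃ₐ[F] K) :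
    σ ^ p ^ m ∈ rootsFixer F (p ^ m) α := by
  rw [mem_rootsFixer]
  intro β hβ
  refine pow_apply_eq_self hη σ m β ?_
  obtain ⟨c, hc⟩ := hα
  rw [hβ, ← hc, σ.commutes]

/-- This lets the action on the roots factor through the maximal pro-`p` quotient. -/
lemma isPGroup_quotient_rootsFixer {p : ℕ} [NeZero p] {η : F} (hη : IsPrimitiveRoot η p) {m : ℕ}
    {α : K} (hα : α ^ p ^ m ∈ Set.range (algebraMap F K)) [(rootsFixer F (p ^ m) α).Normal] :
    IsPGroup p ((K ≃ₐ[F] K) ⧸ rootsFixer F (p ^ m) α) := by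
  intro g
  obtain ⟨σ, rfl⟩ := QuotientGroup.mk_surjective g
  refine ⟨m, ?_⟩
  rw [← QuotientGroup.mk_pow, QuotientGroup.eq_one_iff]
  exact pow_mem_rootsFixer hη hα σ

lemma exists_apply_eq_pow {n : ℕ} [NeZero n] {ω : K} (hω : ω ^ n = 1) (σ : K ≃ₐ[F] K) :
    ∃ t : ℕ, σ ω = ω ^ t := by
  obtain ⟨t, ht⟩ := map_rootsOfUnity_eq_pow_self σ (rootsOfUnity.mkOfPowEq ω hω)
  exact ⟨t, by simpa using ht⟩

/-- Automorphisms that fix `α` commute on the roots of `α ^ n`. -/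
lemma mul_apply_comm {n : ℕ} [NeZero n] {α : K} {σ τ : K ≃ₐ[F] K}
    (hσ : σ α = α) (hτ : τ α = α) {β : K} (hβ : β ^ n = α ^ n) : σ (τ β) = τ (σ β) := by
  rcases eq_or_ne α 0 with rfl | h0
  · rw [zero_pow (NeZero.ne n)] at hβ
    simp [pow_eq_zero_iff (NeZero.ne n) |>.1 hβ]
  have hω : (β / α) ^ n = 1 := by rw [div_pow, hβ, div_self (pow_ne_zero _ h0)]
  obtain ⟨a, ha⟩ := exists_apply_eq_pow hω σ
  obtain ⟨b, hb⟩ := exists_apply_eq_pow hω τ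
  have : β = (β / α) * α := (div_mul_cancel₀ _ h0).symm
  rw [this]
  generalize β / α = ω at *
  simp only [map_mul, hσ, hτ, ha, hb, map_pow]
  rw [← pow_mul, ← pow_mul, mul_comm a b]

lemma commute_mk_rootsFixer {n : ℕ} [NeZero n] {α : K} [(rootsFixer F n α).Normal]
    {σ τ : K ≃ₐ[F] K} (hσ : σ α = α) (hτ : τ α = α) :
    Commute (σ : (K ≃ₐ[F] K) ⧸ rootsFixer F n α) (τ : (K ≃ₐ[F] K) ⧸ rootsFixer F n α) := by
  change _ * _ = _ * _
  rw [← QuotientGroup.mk_mul, ← QuotientGroup.mk_mul, QuotientGroup.eq, mem_rootsFixer]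
  intro β hβ
  rw [AlgEquiv.mul_apply, AlgEquiv.mul_apply, ← mul_apply_comm hσ hτ hβ]
  exact AlgEquiv.symm_apply_apply (σ * τ) β

/-- The power of `ζ` of order `d` lies in `F`, so `σ` fixes it, while `σ` also raises it to the
`t`-th power. -/
lemma modEq_one_of_apply_eq_pow {n d : ℕ} (hn : n ≠ 0) (hd : d ∣ n) {η : F}
    (hη : IsPrimitiveRoot η d) {ζ : K} (hζ : IsPrimitiveRoot ζ n) {σ : K ≃ₐ[F] K} {t : ℕ}
    (ht : σ ζ = ζ ^ t) : t ≡ 1 [MOD d] := by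
  obtain ⟨e, rfl⟩ := hd
  have : NeZero d := ⟨fun h => hn (by simp [h])⟩
  have hω : IsPrimitiveRoot (ζ ^ e) d := hζ.pow (Nat.pos_of_ne_zero hn) (mul_comm d e)
  obtain ⟨c, -, hc⟩ := mem_range_algebraMap_of_pow_eq_one hη hω.pow_eq_one
  have h1 : (ζ ^ e) ^ t = (ζ ^ e) ^ 1 := by
    rw [pow_one, ← pow_mul, mul_comm, pow_mul, ← ht, ← map_pow, ← hc, σ.commutes]
  refine ((Nat.modEq_iff_dvd (a := 1) (b := t)).2 ((hω.zpow_eq_one_iff_dvd _).1 ?_)).symm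
  rw [zpow_sub₀ (hω.ne_zero (NeZero.ne d)), zpow_natCast, zpow_natCast, h1,
    div_self (pow_ne_zero _ (hω.ne_zero (NeZero.ne d)))]

lemma pow_apply_eq_pow_mul {τ : K ≃ₐ[F] K} {ζ α : K} {q E : ℕ} (hζ : τ ζ = ζ ^ q)
    (hα : τ α = ζ ^ E * α) (n : ℕ) :
    (τ ^ n) ζ = ζ ^ q ^ n ∧ (τ ^ n) α = ζ ^ (E * ∑ i ∈ Finset.range n, q ^ i) * α := by
  induction n with
  | zero => simp
  | succ n ih =>
    rw [pow_succ', AlgEquiv.mul_apply, AlgEquiv.mul_apply, ih.1, ih.2, map_mul, map_pow, map_pow,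
      hζ, hα, ← pow_mul, ← pow_mul, ← mul_assoc, ← pow_add, geom_sum_succ, pow_succ']
    refine ⟨rfl, ?_⟩
    congr 2
    ring

/-- Each passage to a `p`-th power multiplies the exponent by a geometric sum of the form `p * (1 +
p * k')`, so its `p`-adic valuation grows by exactly one. -/
lemma exists_pow_prime_pow_apply {p : ℕ} (hp : p.Prime) {σ : K ≃ₐ[F] K} {ζ α : K} {t : ℕ}
    (ht : IsOneUnit p t) (hζ : σ ζ = ζ ^ t) (hα : σ α = ζ * α) (j : ℕ) :
    ∃ k q, IsOneUnit p q ∧ (σ ^ p ^ j) ζ = ζ ^ q ∧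
      (σ ^ p ^ j) α = ζ ^ (p ^ j * (1 + p * k)) * α := by
  induction j with
  | zero => exact ⟨0, t, ht, by simpa using hζ, by simpa using hα⟩
  | succ j ih =>
    obtain ⟨k, q, hq, h1, h2⟩ := ih
    obtain ⟨k', hk'⟩ := hq.exists_geom_sum hp
    obtain ⟨h3, h4⟩ := pow_apply_eq_pow_mul h1 h2 p
    refine ⟨k + k' + p * k * k', q ^ p, hq.pow p, by rw [pow_succ, pow_mul, h3], ?_⟩
    rw [pow_succ, pow_mul, h4, hk']
    congr 2
    ring

/-- If `σ α = ζ α` with `ζ` of order `p ^ (l + 1)`, then `σ ^ p ^ l` moves `α`. -/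
lemma pow_apply_ne {p : ℕ} (hp : p.Prime) {σ : K ≃ₐ[F] K} {ζ α : K} {t l : ℕ}
    (ht : IsOneUnit p t) (hζ : σ ζ = ζ ^ t) (hα : σ α = ζ * α) (h0 : α ≠ 0)
    (hprim : IsPrimitiveRoot ζ (p ^ (l + 1))) : (σ ^ p ^ l) α ≠ α := by
  obtain ⟨k, -, -, -, h⟩ := exists_pow_prime_pow_apply hp ht hζ hα l
  intro h'
  rw [h', eq_comm, mul_eq_right₀ h0, hprim.pow_eq_one_iff_dvd, pow_succ,
    Nat.mul_dvd_mul_iff_left (pow_pos hp.pos l)] at h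
  have : p ∣ 1 := (Nat.dvd_add_left (dvd_mul_right p k)).1 h
  exact hp.one_lt.ne' (Nat.dvd_one.1 this)

/-- Kummer theory: a character of the Galois group with values in `F` and open kernel is given by
the action on an element of `K`. -/
lemma exists_apply_eq_character_mul [IsGalois F K] (χ : (K ≃ₐ[F] K) →* Fˣ)
    (hχ : IsOpen (χ.ker : Set (K ≃ₐ[F] K))) :
    ∃ β : K, β ≠ 0 ∧ ∀ σ : K ≃ₐ[F] K, σ β = algebraMap F K (χ σ) * β := by
  obtain ⟨L, hfin, hnorm, hL⟩ := (krullTopology_mem_nhds_one_iff_of_normal F K _).1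
    (hχ.mem_nhds (one_mem χ.ker))
  have hsurj := AlgEquiv.restrictNormalHom_surjective (F := F) (K₁ := L) (E := K)
  have hker : (AlgEquiv.restrictNormalHom (F := F) (K₁ := K) L).ker ≤ χ.ker := by
    rw [IntermediateField.restrictNormalHom_ker]
    exact hL
  let χL : (L ≃ₐ[F] L) →* Fˣ := MonoidHom.liftOfSurjective _ hsurj ⟨χ, hker⟩
  have hχL : ∀ σ, χL (AlgEquiv.restrictNormalHom L σ) = χ σ := fun σ =>
    MonoidHom.liftOfRightInverse_comp_apply _ _ _ ⟨χ, hker⟩ σ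
  -- The values lie in `F` and are fixed by Galois, so the character is a cocycle and Hilbert 90
  -- applies.
  obtain ⟨β, hβ⟩ := groupCohomology.isMulCoboundary₁_of_isMulCocycle₁_of_aut_to_units
    (K := F) (L := L) (fun g => Units.map (algebraMap F L) (χL g)) (by
      intro g h
      ext
      rw [Units.val_mul, AlgEquiv.smul_units_def]
      simp only [Units.coe_map, MonoidHom.coe_coe]
      erw [g.commutes]
      rw [map_mul, Units.val_mul, map_mul, mul_comm])
  refine ⟨algebraMap L K β, by simp, fun σ => ?_⟩
  have h1 := congrArg (fun z : Lˣ => (z : L)) (hβ (AlgEquiv.restrictNormalHom L σ))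
  have h2 : (AlgEquiv.restrictNormalHom L σ) (β : L) = algebraMap F L (χ σ) * β := by
    rw [← hχL]
    simp only [AlgEquiv.smul_units_def, Units.val_div_eq_div_val, Units.coe_map] at h1
    rw [div_eq_iff β.ne_zero] at h1
    exact h1
  have h3 := AlgEquiv.restrictNormal_commutes σ L (β : L)
  rw [← h3]
  change algebraMap L K ((AlgEquiv.restrictNormalHom L σ) (β : L)) = _
  rw [h2, map_mul, ← IsScalarTower.algebraMap_apply]

end Kummer
-- Characters of exponent `p` on minimal presentations
section FreeProP

lemma isProPGroup_of_finite {p : ℕ} {P : Type u} [Group P] [TopologicalSpace P]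
    [IsTopologicalGroup P] [Finite P] [DiscreteTopology P] (hP : IsPGroup p P) :
    IsProPGroup p P :=
  ⟨inferInstance, inferInstance, fun N _ _ => hP.to_quotient N⟩

lemma frattiniSubgroup_le_ker {p : ℕ} {S : Type v} [Group S] [TopologicalSpace S]
    [IsTopologicalGroup S] {A : Type w} [CommGroup A] [TopologicalSpace A] [T1Space A]
    (hA : ∀ a : A, a ^ p = 1) (φ : S →ₜ* A) : frattiniSubgroup p S ≤ (φ : S →* A).ker := by
  refine Subgroup.topologicalClosure_minimal _ ?_ ?_
  · rw [Subgroup.closure_le]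
    rintro g (⟨a, rfl⟩ | ⟨a, b, rfl⟩)
    · simp [MonoidHom.mem_ker, hA]
    · simp [MonoidHom.mem_ker, commutatorElement_def]
  · have : ((φ : S →* A).ker : Set S) = φ ⁻¹' {1} := by ext; simp [MonoidHom.mem_ker]
    rw [this]
    exact isClosed_singleton.preimage φ.continuous_toFun

lemma tendsto_one_of_finite {X : Type w} {A : Type v} [Group A] [TopologicalSpace A] {f : X → A}
    (hf : {a | f a ≠ 1}.Finite) : Tendsto f cofinite (𝓝 1) := by
  refine tendsto_nhds_of_eventually_eq ?_
  simpa [Filter.eventually_cofinite] using hf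

/-- For a free pro-`p` group, every finitely supported family in a finite abelian group `A` of
exponent `p` comes from a character, which factors through any minimal presentation. -/
lemma exists_character_of_small {p : ℕ} {X : Type w} {S : Type v} [Group S]
    [TopologicalSpace S] [IsTopologicalGroup S] {ι : X → S} (hS : IsFreeProPGroup p ι)
    {G : Type u} [Group G] [TopologicalSpace G] [T2Space G] {π : S →ₜ* G}
    (hπ : IsMinimalPresentation p π) {A : Type v} [CommGroup A] [Finite A]
    (hA : ∀ a : A, a ^ p = 1) {f : X → A} (hf : {a | f a ≠ 1}.Finite) :
    ∃ χ : G →* A, IsOpen (χ.ker : Set G) ∧ ∀ a, χ (π (ι a)) = f a := by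
  let _ : TopologicalSpace A := ⊥
  have : DiscreteTopology A := ⟨rfl⟩
  have : IsTopologicalGroup A := {}
  obtain ⟨φ, hφ, -⟩ := hS.existsUnique_extension A
    (isProPGroup_of_finite fun a => ⟨1, by simpa using hA a⟩) f (tendsto_one_of_finite hf)
  have hker : (π : S →* G).ker ≤ (φ : S →* A).ker :=
    hπ.ker_le_frattini.trans (frattiniSubgroup_le_ker hA φ)
  let χ : G →* A := MonoidHom.liftOfSurjective (π : S →* G) hπ.surjective ⟨φ, hker⟩
  have hχ : ∀ s, χ (π s) = φ s := fun s =>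
    MonoidHom.liftOfRightInverse_comp_apply (π : S →* G) _ _ ⟨(φ : S →* A), hker⟩ s
  refine ⟨χ, ?_, fun a => (hχ _).trans (hφ a)⟩
  have := hS.isProPGroup.compactSpace
  have hq : IsQuotientMap π := π.continuous_toFun.isClosedMap.isQuotientMap π.continuous_toFun
    hπ.surjective
  rw [← hq.isOpen_preimage]
  have : π ⁻¹' (χ.ker : Set G) = φ ⁻¹' {1} := by
    ext s
    simp [MonoidHom.mem_ker, hχ]
  rw [this]
  exact (isOpen_discrete _).preimage φ.continuous_toFun

/-- The universal property only tests groups in the universe of `S`; a finite `A` is moved there by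
`Shrink`. -/
lemma exists_character {p : ℕ} {X : Type w} {S : Type v} [Group S]
    [TopologicalSpace S] [IsTopologicalGroup S] {ι : X → S} (hS : IsFreeProPGroup p ι)
    {G : Type u} [Group G] [TopologicalSpace G] [T2Space G] {π : S →ₜ* G}
    (hπ : IsMinimalPresentation p π) {A : Type*} [CommGroup A] [Finite A]
    (hA : ∀ a : A, a ^ p = 1) {f : X → A} (hf : {a | f a ≠ 1}.Finite) :
    ∃ χ : G →* A, IsOpen (χ.ker : Set G) ∧ ∀ a, χ (π (ι a)) = f a := by
  let e : Shrink.{v} A ≃* A := Shrink.mulEquiv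
  have : Finite (Shrink.{v} A) := Finite.of_equiv A e.symm.toEquiv
  obtain ⟨χ, hχ, h⟩ := exists_character_of_small hS hπ (A := Shrink.{v} A)
    (fun a => e.injective (by simp [hA])) (f := fun a => e.symm (f a)) (by simpa using hf)
  refine ⟨e.toMonoidHom.comp χ, ?_, fun a => by simp [h]⟩
  convert hχ using 2
  ext
  simp [MonoidHom.mem_ker]

end FreeProP

/-! ### Topology of the maximal pro-`p` quotient -/

section MaxProPQuotient

variable {p : ℕ} {G : Type u} [Group G] [TopologicalSpace G]

lemma proPKernel_le {N : Subgroup G} [hN : N.Normal] (ho : IsOpen (N : Set G))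
    (hp : IsPGroup p (G ⧸ N)) : proPKernel p G ≤ N :=
  sInf_le ⟨hN, ho, hp⟩

lemma isClosed_proPKernel [IsTopologicalGroup G] : IsClosed (proPKernel p G : Set G) := by
  rw [proPKernel, Subgroup.coe_sInf]
  refine isClosed_biInter ?_
  rintro N ⟨-, hN, -⟩
  exact Subgroup.isClosed_of_isOpen N hN

instance [IsTopologicalGroup G] : T2Space (MaxProPQuotient p G) := by
  have : IsClosed (proPKernel p G : Set G) := isClosed_proPKernel
  infer_instance

/-- Lifts of a family that tends to `1` in the maximal pro-`p` quotient. -/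
lemma finite_notMem_of_tendsto [IsTopologicalGroup G] {X : Type w} {g : X → G}
    (hg : Tendsto (fun a => (g a : MaxProPQuotient p G)) cofinite (𝓝 1))
    {N : Subgroup G} [N.Normal] (ho : IsOpen (N : Set G)) (hp : IsPGroup p (G ⧸ N)) :
    {a | g a ∉ N}.Finite := by
  have h1 : (QuotientGroup.mk '' (N : Set G) : Set (MaxProPQuotient p G)) ∈ 𝓝 1 :=
    (QuotientGroup.isOpenMap_coe _ ho).mem_nhds ⟨1, one_mem N, rfl⟩
  have h2 := hg h1
  rw [Filter.mem_map, Filter.mem_cofinite] at h2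
  refine h2.subset fun a ha h => ha ?_
  obtain ⟨x, hx, hxa⟩ := h
  have := proPKernel_le ho hp (QuotientGroup.eq.1 hxa)
  simpa using N.mul_mem hx this

end MaxProPQuotient

/-! ### Lifting Kummer cocycles from order `p` to order `p ^ m` -/

section Lifting

variable {F : Type u} {K : Type v} [Field F] [Field K] [Algebra F K]

/-- If prescribed families of `p`-th roots of unity are Kummer cocycles, then so are prescribed
families of `p ^ m`-th roots of unity. -/
lemma exists_kummer_element [Algebra.IsAlgebraic F K] [IsSepClosed K] {p : ℕ} [NeZero p]
    [NeZero (p : K)]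
    {η : F} (hη : IsPrimitiveRoot η p) {X : Type w} {g : X → K ≃ₐ[F] K}
    (hg : ∀ N : Subgroup (K ≃ₐ[F] K), ∀ _ : N.Normal, IsOpen (N : Set (K ≃ₐ[F] K)) →
      IsPGroup p ((K ≃ₐ[F] K) ⧸ N) → {a | g a ∉ N}.Finite)
    (hχ : ∀ f : X → rootsOfUnity p F, {a | f a ≠ 1}.Finite → ∃ β : K, β ≠ 0 ∧
      β ^ p ∈ Set.range (algebraMap F K) ∧ ∀ a, g a β = algebraMap F K (f a : Fˣ) * β)
    (m : ℕ) (f : X → K) (hf : ∀ a, f a ^ p ^ m = 1) (hfin : {a | f a ≠ 1}.Finite) :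
    ∃ α : K, α ≠ 0 ∧ α ^ p ^ m ∈ Set.range (algebraMap F K) ∧ ∀ a, g a α = f a * α := by
  induction m generalizing f with
  | zero => exact ⟨1, one_ne_zero, ⟨1, by simp⟩, fun a => by simpa using (hf a).symm⟩
  | succ m ih =>
    have h1 : ∀ a, ∃ c : F, c ^ p = 1 ∧ algebraMap F K c = f a ^ p ^ m := fun a =>
      mem_range_algebraMap_of_pow_eq_one hη (by rw [← pow_mul, ← pow_succ]; exact hf a)
    choose c hc hcf using h1
    obtain ⟨β, hβ, hβp, hgβ⟩ := hχ (fun a => rootsOfUnity.mkOfPowEq (c a) (hc a)) (by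
      refine hfin.subset fun a ha h => ha ?_
      have : c a = 1 := (algebraMap F K).injective (by rw [hcf, h, one_pow, map_one])
      ext
      simpa using this)
    have hpm : NeZero ((p ^ m : ℕ) : K) := by
      rw [Nat.cast_pow]; exact ⟨pow_ne_zero _ (NeZero.ne (p : K))⟩
    -- The cocycle of `γ` agrees with `f` after raising to the power `p ^ m`, so the discrepancy
    -- consists of `p ^ m`-th roots of unity.
    obtain ⟨γ, hγ⟩ := IsSepClosed.exists_pow_nat_eq β (p ^ m)
    have hγ0 : γ ≠ 0 := by
      rintro rfl
      exact hβ (by rw [← hγ, zero_pow (pow_ne_zero _ (NeZero.ne p))])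
    have hγF : γ ^ p ^ (m + 1) ∈ Set.range (algebraMap F K) := by
      rwa [pow_succ, pow_mul, hγ]
    have hN := rootsFixer_normal hγF
    have hfin' := hg _ hN (isOpen_rootsFixer (pow_pos (NeZero.pos p) _) γ)
      (isPGroup_quotient_rootsFixer hη hγF)
    have hfix : ∀ a, g a ∈ rootsFixer F (p ^ (m + 1)) γ → g a γ = γ := fun a ha =>
      mem_rootsFixer.1 ha γ rfl
    -- The induction hypothesis realises the discrepancy; its support is finite because all but
    -- finitely many `g a` fix `γ`.
    obtain ⟨δ, hδ0, hδF, hδ⟩ := ih (fun a => f a / (g a γ / γ)) (by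
      intro a
      have h2 : (g a γ) ^ p ^ m = f a ^ p ^ m * γ ^ p ^ m := by
        rw [← map_pow, hγ, hgβ, ← hcf]
        simp
      have h3 : f a ≠ 0 := by
        intro h
        have := hf a
        rw [h, zero_pow (pow_ne_zero _ (NeZero.ne p))] at this
        exact zero_ne_one this
      rw [div_pow, div_pow, h2, mul_div_cancel_right₀ _ (pow_ne_zero _ hγ0),
        div_self (pow_ne_zero _ h3)])
      ((hfin.union hfin').subset (by
        intro a ha
        by_contra h
        simp only [Set.mem_union, Set.mem_ofPred_eq, not_or, not_not] at h
        exact ha (by simp [h.1, hfix a h.2, hγ0])))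
    refine ⟨γ * δ, mul_ne_zero hγ0 hδ0, ?_, fun a => ?_⟩
    · obtain ⟨c1, h1⟩ := hγF
      obtain ⟨c2, h2⟩ := hδF
      exact ⟨c1 * c2 ^ p, by rw [map_mul, map_pow, h1, h2, mul_pow, ← pow_mul, ← pow_succ]⟩
    · have : g a γ ≠ 0 := by simpa using hγ0
      rw [map_mul, hδ]
      field_simp

end Lifting

/-! ### Vanishing of hyper-commutators -/

section Brackets

/-- A homomorphism under which the `y i` commute kills every hyper-commutator in which only
commutators of letters other than `x ^ ± 1` appear. -/
lemma BracketWord.map_eval_eq_one {I : Type w} {S : Type v} [Group S] {x : S} {y : I → S}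
    {H : Type u} [Group H] (ψ : S →* H) (hψ : ∀ i j, Commute (ψ (y i)) (ψ (y j)))
    (c : BracketWord (Letter (Option I))) (hc : c.IsHyperCommutator)
    (hav : ∀ a b : Letter (Option I), c.Appears a b → a.AvoidsX ∧ b.AvoidsX) :
    ψ (c.eval (generators x y)) = 1 := by
  have hletter : ∀ a : Letter (Option I), a.AvoidsX → ∃ i,
      ψ (a.eval (generators x y)) = ψ (y i) ∨ ψ (a.eval (generators x y)) = (ψ (y i))⁻¹ := by
    rintro ((_ | i) | (_ | i)) ⟨h1, h2⟩
    · exact absurd rfl h1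
    · exact ⟨i, Or.inl rfl⟩
    · exact absurd rfl h2
    · exact ⟨i, Or.inr (map_inv _ _)⟩
  induction c with
  | letter a => obtain ⟨b, b', h⟩ := hc; cases h
  | bracket b d ihb ihd =>
    simp only [BracketWord.eval, map_commutatorElement]
    -- If either side is a proper bracket it already dies; otherwise both are letters, and this
    -- commutator itself appears.
    by_cases hb : b.IsHyperCommutator
    · rw [ihb hb fun a a' h => hav a a' (Or.inr (Or.inl h)), commutatorElement_one_left]
    by_cases hd : d.IsHyperCommutator
    · rw [ihd hd fun a a' h => hav a a' (Or.inr (Or.inr h)), commutatorElement_one_right]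
    cases b with
    | bracket b b' => exact absurd ⟨b, b', rfl⟩ hb
    | letter a =>
      cases d with
      | bracket d d' => exact absurd ⟨d, d', rfl⟩ hd
      | letter a' =>
        obtain ⟨h1, h2⟩ := hav a a' (Or.inl ⟨rfl, rfl⟩)
        obtain ⟨i, hi⟩ := hletter a h1
        obtain ⟨j, hj⟩ := hletter a' h2
        rw [commutatorElement_eq_one_iff_commute]
        simp only [BracketWord.eval]
        rcases hi with hi | hi <;> rcases hj with hj | hj <;> rw [hi, hj]
        · exact hψ i j
        · exact (hψ i j).inv_right
        · exact (hψ i j).inv_left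
        · exact (hψ i j).inv_inv

end Brackets
-- The forbidden relations
section Main

lemma HasRootsOfUnity.exists_isPrimitiveRoot {p : ℕ} [Fact p.Prime] {F : Type u} [Field F]
    (hF : HasRootsOfUnity p F) : ∃ η : F, IsPrimitiveRoot η p := by
  by_cases hp : p = 2
  · obtain ⟨ζ, hζ⟩ := hF.2 hp
    subst hp
    exact ⟨ζ ^ 2, hζ.pow (by norm_num) (by norm_num)⟩
  · exact hF.1 hp

lemma natCast_ne_zero_of_isPrimitiveRoot {p : ℕ} [hp : Fact p.Prime] {F : Type u} [Field F]
    {η : F} (hη : IsPrimitiveRoot η p) : (p : F) ≠ 0 :=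
  have : NeZero p := ⟨hp.out.ne_zero⟩
  hη.neZero'.ne

/-- Every family of `p ^ m`-th roots of unity with finite support is the Kummer cocycle of an
element, on lifts of the generators of a minimal presentation of `GalP p F`. -/
lemma exists_kummer_element_of_minimalPresentation {p : ℕ} [hp : Fact p.Prime] {F : Type u}
    [Field F] {η : F} (hη : IsPrimitiveRoot η p) {X : Type w} {S : Type v} [Group S]
    [TopologicalSpace S] [IsTopologicalGroup S] {ι : X → S} (hS : IsFreeProPGroup p ι)
    {π : S →ₜ* GalP p F} (hπ : IsMinimalPresentation p π) {g : X → AbsGal F}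
    (hg : ∀ a, (g a : GalP p F) = π (ι a)) (m : ℕ) (f : X → SeparableClosure F)
    (hf : ∀ a, f a ^ p ^ m = 1) (hfin : {a | f a ≠ 1}.Finite) :
    ∃ α : SeparableClosure F, α ≠ 0 ∧ α ^ p ^ m ∈ Set.range (algebraMap F (SeparableClosure F)) ∧
      ∀ a, g a α = f a * α := by
  have : NeZero p := ⟨hp.out.ne_zero⟩
  have : NeZero (p : SeparableClosure F) := ⟨by
    rw [← map_natCast (algebraMap F (SeparableClosure F))]
    exact (map_ne_zero _).2 (natCast_ne_zero_of_isPrimitiveRoot hη)⟩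
  refine exists_kummer_element hη (g := g) (fun N _ ho hpN => ?_) (fun f hf => ?_) m f hf hfin
  · refine finite_notMem_of_tendsto (p := p) ?_ ho hpN
    simp only [hg]
    have h1 : Tendsto π (𝓝 1) (𝓝 1) := map_one π ▸ π.continuous_toFun.tendsto 1
    exact h1.comp hS.tendsto_one
  · obtain ⟨χ, hχ, hχf⟩ := exists_character hS hπ (A := rootsOfUnity p F)
      (fun a => Subtype.ext a.2) hf
    let χ' : AbsGal F →* Fˣ := (rootsOfUnity p F).subtype.comp (χ.comp (QuotientGroup.mk' _))
    have hker : (χ'.ker : Set (AbsGal F)) = QuotientGroup.mk ⁻¹' (χ.ker : Set (GalP p F)) := by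
      ext σ
      simp [χ', MonoidHom.mem_ker]
    obtain ⟨β, hβ, h⟩ := exists_apply_eq_character_mul χ'
      (by rw [hker]; exact hχ.preimage QuotientGroup.continuous_mk)
    refine ⟨β, hβ, ?_, fun a => ?_⟩
    · rw [InfiniteGalois.mem_range_algebraMap_iff_fixed]
      intro σ
      have : ((χ' σ : Fˣ) : F) ^ p = 1 := by
        have := (χ (σ : GalP p F)).2
        rw [mem_rootsOfUnity] at this
        rw [← Units.val_pow_eq_pow_val, ← Units.val_one]
        exact congrArg Units.val this
      rw [map_pow, h, mul_pow, ← map_pow, this, map_one, one_mul]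
    · rw [h]
      congr 3
      change ((χ (g a : GalP p F) : rootsOfUnity p F) : Fˣ) = _
      rw [hg, hχf]

/-- A power `x ^ (p ^ l n)` times a product of hyper-commutators in which no commutator involving
`x ^ ± 1` appears is not a relation of `GalP p F`. -/
lemma pow_mul_notMem_ker {p : ℕ} [hp : Fact p.Prime] {F : Type u} [Field F]
    (hF : HasRootsOfUnity p F) {I : Type w} {S : Type v} [Group S] [TopologicalSpace S]
    [IsTopologicalGroup S] {x : S} {y : I → S} (hS : IsFreeProPGroup p (generators x y))
    {π : S →ₜ* GalP p F} (hπ : IsMinimalPresentation p π) {l : ℕ} (hl : 1 ≤ l) {n : ℤ}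
    (hn : IsCoprime (p : ℤ) n) {s : S} {cs : List (BracketWord (Letter (Option I)))}
    (hs : IsCommutatorExpression (generators x y) cs s)
    (hav : ∀ c ∈ cs, ∀ a b : Letter (Option I), c.Appears a b → a.AvoidsX ∧ b.AvoidsX) :
    x ^ ((p : ℤ) ^ l * n) * s ∉ (π : S →* GalP p F).ker := by
  intro hr
  have hp0 : NeZero p := ⟨hp.out.ne_zero⟩
  obtain ⟨η, hη⟩ := hF.exists_isPrimitiveRoot
  have hpK : NeZero ((p ^ (l + 1) : ℕ) : SeparableClosure F) := ⟨by
    rw [← map_natCast (algebraMap F (SeparableClosure F))]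
    rw [Nat.cast_pow]
    exact (map_ne_zero _).2 (pow_ne_zero _ (natCast_ne_zero_of_isPrimitiveRoot hη))⟩
  obtain ⟨ζ, hζ⟩ :=
    HasEnoughRootsOfUnity.exists_primitiveRoot (SeparableClosure F) (p ^ (l + 1))
  have hlift : ∀ a, ∃ g : AbsGal F, (g : GalP p F) = π (generators x y a) := fun a =>
    QuotientGroup.mk_surjective _
  choose g hg using hlift
  -- Order `p ^ (l + 1)`, one step above `p ^ l`, is what makes `x ^ p ^ l` visible on `α`.
  obtain ⟨α, hα0, hαF, hα⟩ := exists_kummer_element_of_minimalPresentation hη hS hπ hg (l + 1)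
    (fun a => a.elim ζ fun _ => 1) (by rintro (_ | i) <;> simp [hζ.pow_eq_one])
    ((Set.finite_singleton none).subset (by rintro (_ | i) <;> simp))
  have hαx : g none α = ζ * α := hα none
  have hαy : ∀ i, g (some i) α = α := fun i => by simpa using hα (some i)
  have hN := rootsFixer_normal hαF
  set N := rootsFixer F (p ^ (l + 1)) α with hNdef
  have hle : proPKernel p (AbsGal F) ≤ N :=
    proPKernel_le (isOpen_rootsFixer (pow_pos hp.out.pos _) α) (isPGroup_quotient_rootsFixer hη hαF)
  let θ : GalP p F →* AbsGal F ⧸ N := QuotientGroup.map _ N (MonoidHom.id _) hle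
  let ψ : S →* AbsGal F ⧸ N := θ.comp (π : S →* GalP p F)
  have hψ : ∀ a, ψ (generators x y a) = (g a : AbsGal F ⧸ N) := fun a => by
    change θ (π (generators x y a)) = _
    rw [← hg]
    rfl
  have hψs : ψ s = 1 := by
    rw [hs.2, map_list_prod, List.map_map]
    refine List.prod_eq_one fun z hz => ?_
    obtain ⟨c, hc, rfl⟩ := List.mem_map.1 hz
    refine BracketWord.map_eval_eq_one ψ (fun i j => ?_) c (hs.1 c hc) (hav c hc)
    have hi := hψ (some i)
    have hj := hψ (some j)
    simp only [generators] at hi hj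
    rw [hi, hj]
    exact commute_mk_rootsFixer (hαy i) (hαy j)
  have hψr : ψ (x ^ ((p : ℤ) ^ l * n) * s) = 1 := by
    change θ _ = 1
    rw [MonoidHom.mem_ker.1 hr, map_one]
  rw [map_mul, hψs, mul_one, map_zpow] at hψr
  have hτn : (g none ^ p ^ l) ^ n ∈ N := by
    rw [← QuotientGroup.eq_one_iff, QuotientGroup.mk_zpow, QuotientGroup.mk_pow, ← hψ none,
      ← zpow_natCast, ← zpow_mul, Nat.cast_pow]
    exact hψr
  have hτp : (g none ^ p ^ l) ^ p ∈ N := by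
    rw [← pow_mul, ← pow_succ]
    exact pow_mem_rootsFixer hη hαF _
  -- Bézout removes `n`, since the quotient by `N` has exponent dividing `p ^ (l + 1)`.
  have hτ : g none ^ p ^ l ∈ N := by
    obtain ⟨a, b, hab⟩ := hn
    rw [← zpow_one (g none ^ p ^ l), ← hab, zpow_add, mul_comm a, mul_comm b, zpow_mul, zpow_mul,
      zpow_natCast]
    exact N.mul_mem (N.zpow_mem hτp a) (N.zpow_mem hτn b)
  obtain ⟨t, ht⟩ := exists_apply_eq_pow hζ.pow_eq_one (g none)
  have hpl : p ^ (l + 1) ≠ 0 := pow_ne_zero _ hp.out.ne_zero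
  have ht1 : IsOneUnit p t := by
    refine ⟨modEq_one_of_apply_eq_pow hpl (dvd_pow_self p l.succ_ne_zero) hη hζ ht, ?_⟩
    rintro rfl
    obtain ⟨ω, hω⟩ := hF.2 rfl
    -- Here `1 ≤ l` guarantees that `4` divides the order of `ζ`.
    exact modEq_one_of_apply_eq_pow hpl (pow_dvd_pow 2 (by omega : 2 ≤ l + 1)) hω hζ ht
  exact pow_apply_ne hp.out ht1 ht hαx hα0 hζ (mem_rootsFixer.1 hτ α rfl)

end Main

/-! ### The one-relator quotients -/

section OneRelator

lemma IsFreeProPGroup.comp_equiv {p : ℕ} {X : Type w} {Y : Type*} {S : Type v} [Group S]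
    [TopologicalSpace S] [IsTopologicalGroup S] {ι : X → S} (h : IsFreeProPGroup p ι)
    (e : Y ≃ X) : IsFreeProPGroup p (ι ∘ e) := by
  refine ⟨h.isProPGroup, h.tendsto_one.comp e.injective.tendsto_cofinite, ?_⟩
  intro P _ _ _ hP f hf
  obtain ⟨φ, hφ, huniq⟩ := h.existsUnique_extension P hP (f ∘ e.symm)
    (hf.comp e.symm.injective.tendsto_cofinite)
  refine ⟨φ, fun a => by simp [hφ], fun φ' hφ' => huniq φ' fun a => ?_⟩
  simpa using hφ' (e.symm a)

instance frattiniSubgroup_normal (p : ℕ) (S : Type v) [Group S] [TopologicalSpace S]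
    [IsTopologicalGroup S] : (frattiniSubgroup p S).Normal := by
  have : (Subgroup.closure
      ({g | ∃ a : S, g = a ^ p} ∪ {g | ∃ a b : S, g = ⁅a, b⁆})).Normal := by
    refine ⟨fun n hn g => ?_⟩
    have h : ⁅g, n⁆ * n = g * n * g⁻¹ := by rw [commutatorElement_def]; group
    rw [← h]
    exact Subgroup.mul_mem _ (Subgroup.subset_closure (Or.inr ⟨g, n, rfl⟩)) hn
  exact Subgroup.is_normal_topologicalClosure _

lemma pow_mem_frattiniSubgroup (p : ℕ) {S : Type v} [Group S] [TopologicalSpace S]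
    [IsTopologicalGroup S] (a : S) : a ^ p ∈ frattiniSubgroup p S :=
  Subgroup.le_topologicalClosure _ (Subgroup.subset_closure (Or.inl ⟨a, rfl⟩))

lemma commutatorElement_mem_frattiniSubgroup (p : ℕ) {S : Type v} [Group S] [TopologicalSpace S]
    [IsTopologicalGroup S] (a b : S) : ⁅a, b⁆ ∈ frattiniSubgroup p S :=
  Subgroup.le_topologicalClosure _ (Subgroup.subset_closure (Or.inr ⟨a, b, rfl⟩))

lemma oddRelation_mem_frattiniSubgroup {p k : ℕ} (hk : 1 ≤ k) (m : ℕ) {S : Type v} [Group S]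
    [TopologicalSpace S] [IsTopologicalGroup S] (x : Fin (2 * m + 1) → S) :
    oddRelation p k m x ∈ frattiniSubgroup p S := by
  refine Subgroup.mul_mem _ ?_ (Subgroup.list_prod_mem _ fun z hz => ?_)
  · obtain ⟨k, rfl⟩ := Nat.exists_eq_add_of_le' hk
    rw [pow_succ, pow_mul]
    exact pow_mem_frattiniSubgroup p _
  · obtain ⟨j, rfl⟩ := (List.mem_ofFn' _ _).1 hz
    exact commutatorElement_mem_frattiniSubgroup p _ _

lemma closedNormalClosure_le {S : Type v} [Group S] [TopologicalSpace S] [IsTopologicalGroup S]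
    {r : S} {N : Subgroup S} [N.Normal] (hN : IsClosed (N : Set S)) (hr : r ∈ N) :
    closedNormalClosure r ≤ N :=
  Subgroup.topologicalClosure_minimal _
    (Subgroup.normalClosure_le_normal (Set.singleton_subset_iff.2 hr)) hN

lemma isEmpty_quotient_oddRelation {p : ℕ} [Fact p.Prime] {F : Type u} [Field F]
    (hF : HasRootsOfUnity p F) (m : ℕ) {k : ℕ} (hk : 1 ≤ k) {S : Type v} [Group S]
    [TopologicalSpace S] [IsTopologicalGroup S] {x : Fin (2 * m + 1) → S}
    (hx : IsFreeProPGroup p x) :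
    IsEmpty ((S ⧸ closedNormalClosure (oddRelation p k m x)) ≃ₜ* GalP p F) := by
  refine ⟨fun e => ?_⟩
  set r := oddRelation p k m x with hr
  let y : Fin (2 * m) → S := fun i => x i.succ
  have hgen : generators (x 0) y = x ∘ (finSuccEquiv (2 * m)).symm := by
    funext a
    cases a <;> simp [generators, y]
  have hS : IsFreeProPGroup p (generators (x 0) y) := hgen ▸ hx.comp_equiv _
  let π : S →ₜ* GalP p F :=
    { toMonoidHom := (e : _ →* GalP p F).comp (QuotientGroup.mk' (closedNormalClosure r))
      continuous_toFun := e.continuous_toFun.comp QuotientGroup.continuous_mk }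
  have hker : (π : S →* GalP p F).ker = closedNormalClosure r := by
    ext s
    exact (map_eq_one_iff e e.injective).trans (QuotientGroup.eq_one_iff s)
  -- Minimality uses `1 ≤ k`: the relator is then a product of a `p`-th power and commutators.
  have hπ : IsMinimalPresentation p π := by
    refine ⟨e.surjective.comp QuotientGroup.mk_surjective, ?_⟩
    rw [hker]
    exact closedNormalClosure_le (Subgroup.isClosed_topologicalClosure _)
      (oddRelation_mem_frattiniSubgroup hk m x)
  let c : Fin m → BracketWord (Letter (Option (Fin (2 * m)))) := fun j =>
    .bracket (.letter (.pos (some ⟨2 * j, by omega⟩))) (.letter (.pos (some ⟨2 * j + 1, by omega⟩)))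
  have hmem : r ∈ (π : S →* GalP p F).ker := by
    rw [hker]
    exact Subgroup.le_topologicalClosure _ (Subgroup.subset_normalClosure rfl)
  refine pow_mul_notMem_ker hF hS hπ hk isCoprime_one_right
    (cs := List.ofFn c) ⟨fun z hz => ?_, rfl⟩ (fun z hz a b h => ?_) ?_
  · obtain ⟨j, rfl⟩ := (List.mem_ofFn' _ _).1 hz
    exact ⟨_, _, rfl⟩
  · obtain ⟨j, rfl⟩ := (List.mem_ofFn' _ _).1 hz
    rcases h with ⟨h1, h2⟩ | h | h
    · cases h1
      cases h2
      exact ⟨⟨by simp, by simp⟩, ⟨by simp, by simp⟩⟩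
    · exact h.elim
    · exact h.elim
  · convert hmem using 1
    rw [hr, oddRelation, List.map_ofFn, mul_one, ← Nat.cast_pow, zpow_natCast]
    rfl

end OneRelator
end ProP

theorem theorem3p6 (p : ℕ) [Fact p.Prime] (F : Type u) [Field F]
    (hF : ProP.HasRootsOfUnity p F) :
    (∀ (I : Type w) (S : Type v) [Group S] [TopologicalSpace S] [IsTopologicalGroup S]
        (x : S) (y : I → S) (_ : ProP.IsFreeProPGroup p (ProP.generators x y))
        (π : S →ₜ* ProP.GalP p F) (_ : ProP.IsMinimalPresentation p π),
        ¬ ∃ (l : ℕ) (n : ℤ) (s : S) (cs : List (ProP.BracketWord (ProP.Letter (Option I)))),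
          1 ≤ l ∧ IsCoprime (p : ℤ) n ∧
          s ∈ (commutator S).topologicalClosure ∧
          ProP.IsCommutatorExpression (ProP.generators x y) cs s ∧
          (∀ c ∈ cs, ∀ a b : ProP.Letter (Option I), c.Appears a b → a.AvoidsX ∧ b.AvoidsX) ∧
          x ^ ((p : ℤ) ^ l * n) * s ∈ (π : S →* ProP.GalP p F).ker) ∧
    (∀ (m k : ℕ) (_ : 1 ≤ k) (S : Type v) [Group S] [TopologicalSpace S] [IsTopologicalGroup S]
        (x : Fin (2 * m + 1) → S) (_ : ProP.IsFreeProPGroup p x),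
        IsEmpty ((S ⧸ ProP.closedNormalClosure (ProP.oddRelation p k m x)) ≃ₜ*
          ProP.GalP p F)) := by
  refine ⟨?_, fun m k hk S _ _ _ x hx => ProP.isEmpty_quotient_oddRelation hF m hk hx⟩
  rintro I S _ _ _ x y hS π hπ ⟨l, n, s, cs, hl, hn, -, hs, hav, hr⟩
  exact ProP.pow_mul_notMem_ker hF hS hπ hl hn hs hav hr
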